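/- Let $n\ge 2$, let $\Omega\subset\mathbb{R}^n$ be a convex domain (a convex open set), and let $F$ be a Finsler metric on $\Omega$: a function $F(x,y)$, $x\in\Omega$, $y\in\mathbb{R}^n$, which is $C^\infty$ and positive for $y\neq 0$, satisfies $F(x,\lambda y)=\lambda F(x,y)$ for $\lambda>0$, and whose fundamental tensor $g_{ij}=\tfrac12[F^2]_{y^iy^j}$ is positive definite for $y\ne 0$. Suppose that $F$ is spherically symmetric, that is, $F(x,y)=\phi(r,u,v)$ with $r=|x|$, $u=|y|$, $v=\langle x,y\rangle$ for some function $\phi$. Let $$G^i=\tfrac14 g^{il}\big([F^2]_{x^ky^l}y^k-[F^2]_{x^l}\big)$$ be the spray coefficients of $F$ in the standard coordinates of $\mathbb{R}^n$. Call $F$ projectively flat on $\Omega$ if its geodesics, the regular solutions of $\ddot\gamma^i+2G^i(\gamma,\dot\gamma)=0$ in $\Omega$, are straight as point sets, and dually flat on $\Omega$ if $G^i=-\tfrac12 g^{ij}H_{y^j}$ for some function $H(x,y)$ which is $C^\infty$ for $y\neq0$ and positively homogeneous of degree $3$ in $y$ (that is, the standard coordinates are adapted). Then $F$ is both projectively flat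 and dually flat on $\Omega$ if and only if there are constants $k,c\in\mathbb{R}$ with $k-c^2r^2>0$ on $\Omega$ such that, for all $x\in\Omega$ and $y\in\mathbb{R}^n$, $$\phi(r,u,v)=\frac{\sqrt{(k-c^2r^2)u^2+c^2v^2}+cv}{k-c^2r^2}.$$ Moreover, these metrics are deformations of the Funk metric: the right-hand side is a $C^\infty$ function of $(k,c,x,y)$ where $k-c^2|x|^2>0$ and $y\ne0$, and for $k=c=1$ it is, on the open unit ball, the Funk metric $$\frac{\sqrt{|y|^2-(|x|^2|y|^2-\langle x,y\rangle^2)}+\langle x,y\rangle}{1-|x|^2}.$$ -/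

import Mathlib

open scoped ContDiff

noncomputable section

namespace FinslerGeom

/-- The model space `ℝⁿ` with its Euclidean norm and inner product. -/
abbrev E (n : ℕ) : Type := EuclideanSpace ℝ (Fin n)

variable {n : ℕ}

/-- The partial derivative `∂f/∂xⁱ` of a function `f(x, y)`. -/
def dx (i : Fin n) (f : E n → E n → ℝ) (x y : E n) : ℝ :=
  fderiv ℝ (fun x' => f x' y) x (EuclideanSpace.single i 1)

/-- The partial derivative `∂f/∂yⁱ` of a function `f(x, y)`. -/
def dy (i : Fin n) (f : E n → E n → ℝ) (x y : E n) : ℝ :=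
  fderiv ℝ (fun y' => f x y') y (EuclideanSpace.single i 1)

/-- The function `F²`. -/
def squared (F : E n → E n → ℝ) : E n → E n → ℝ := fun x y => F x y ^ 2

/-- The fundamental tensor `g_{ij}(x, y) = ½ [F²]_{yⁱ yʲ}(x, y)`. -/
def fundamentalTensor (F : E n → E n → ℝ) (x y : E n) : Matrix (Fin n) (Fin n) ℝ :=
  Matrix.of fun i j => (1 / 2 : ℝ) * dy i (dy j (squared F)) x y

/-- `F` is a Finsler metric on the open set `Ω ⊆ ℝⁿ`: it is smooth away from the zero section,
positive there, positively homogeneous of degree one in `y`, and its fundamental tensor is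
positive definite. -/
structure IsFinslerMetric (Ω : Set (E n)) (F : E n → E n → ℝ) : Prop where
  smooth : ContDiffOn ℝ ∞ (fun p : E n × E n => F p.1 p.2) (Ω ×ˢ {0}ᶜ)
  pos : ∀ x ∈ Ω, ∀ y, y ≠ 0 → 0 < F x y
  homog : ∀ x ∈ Ω, ∀ y, ∀ t : ℝ, 0 < t → F x (t • y) = t * F x y
  posDef : ∀ x ∈ Ω, ∀ y, y ≠ 0 → (fundamentalTensor F x y).PosDef

/-- The spray coefficients
`Gⁱ = ¼ gⁱˡ ([F²]_{xᵏ yˡ} yᵏ - [F²]_{xˡ})`. -/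
def spray (F : E n → E n → ℝ) (x y : E n) : E n :=
  WithLp.toLp 2 fun i =>
    (1 / 4 : ℝ) * ∑ l, (fundamentalTensor F x y)⁻¹ i l *
      ((∑ k, dx k (dy l (squared F)) x y * y k) - dx l (squared F) x y)

/-- `γ`, restricted to the open interval `I`, is a (regular) geodesic of `F` in `Ω`:
`γ'' + 2 G(γ, γ') = 0`. -/
structure IsGeodesicOn (Ω : Set (E n)) (F : E n → E n → ℝ) (γ : ℝ → E n) (I : Set ℝ) :
    Prop where
  isOpen : IsOpen I
  ordConnected : I.OrdConnected
  mem : ∀ t ∈ I, γ t ∈ Ω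
  differentiableAt : ∀ t ∈ I, DifferentiableAt ℝ γ t
  deriv_ne_zero : ∀ t ∈ I, deriv γ t ≠ 0
  equation : ∀ t ∈ I, HasDerivAt (deriv γ) (-((2 : ℝ) • spray F (γ t) (deriv γ t))) t

/-- `F` is projectively flat on `Ω`: as point sets, its geodesics are straight. -/
def IsProjectivelyFlat (Ω : Set (E n)) (F : E n → E n → ℝ) : Prop :=
  ∀ (γ : ℝ → E n) (I : Set ℝ), IsGeodesicOn Ω F γ I → Collinear ℝ (γ '' I)

/-- `F` is dually flat on `Ω` (the standard coordinates are adapted): `Gⁱ = -½ gⁱʲ H_{yʲ}` for a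
function `H`, smooth away from the zero section and positively homogeneous in `y`. Its degree
is three, because the spray is homogeneous of degree two. -/
def IsDuallyFlat (Ω : Set (E n)) (F : E n → E n → ℝ) : Prop :=
  ∃ H : E n → E n → ℝ,
    ContDiffOn ℝ ∞ (fun p : E n × E n => H p.1 p.2) (Ω ×ˢ {0}ᶜ) ∧
    (∀ x ∈ Ω, ∀ y, y ≠ 0 → ∀ t : ℝ, 0 < t → H x (t • y) = t ^ 3 * H x y) ∧
    ∀ x ∈ Ω, ∀ y, y ≠ 0 → ∀ i,
      spray F x y i = -(1 / 2 : ℝ) * ∑ j, (fundamentalTensor F x y)⁻¹ i j * dy j H x y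

/-- The two-parameter family `(√((k - c²r²)u² + c²v²) + cv) / (k - c²r²)`. -/
def funkFamily (k c r u v : ℝ) : ℝ :=
  (√((k - c ^ 2 * r ^ 2) * u ^ 2 + c ^ 2 * v ^ 2) + c * v) / (k - c ^ 2 * r ^ 2)

/-- The Funk metric of the open unit ball. -/
def funkMetric (x y : E n) : ℝ :=
  (√(‖y‖ ^ 2 - (‖x‖ ^ 2 * ‖y‖ ^ 2 - inner ℝ x y ^ 2)) + inner ℝ x y) / (1 - ‖x‖ ^ 2)

end FinslerGeom

end

/-! Everything turns on the Funk equation F_{x^l} = C F F_{y^l}. Straight geodesics mean G = P y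
(`IsProjectivelyFlat.spray_eq_smul` and its converse). Since g y = F F_y, lowering the index in G =
-½ g⁻¹ H_y gives H_y = -2PF F_y, and Euler's identity gives 3H = -2PF². Hence H/F³ does not depend
on y, and P = ½ C(x) F (`IsDuallyFlat.exists_spray_eq`). A spray of this form is equivalent to the
Funk equation (`IsFinslerMetric.spray_eq_of_funk`, `IsFinslerMetric.funk_of_spray_eq`).

Put z = y + C F x. Rotation invariance combined with the Funk equation makes z proportional to the
y-gradient of F, which forces |z|² = k(x) F² (`IsFinslerMetric.exists_level`). The Funk equation
says that F is stationary in the directions (w, -CFw). Differentiating the level identity along them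
relates dC to dk, and comparing y ⟂ x with y = x kills both. So k and C are constants on the
connected set Ω, and the family is the positive root of the quadratic |y + cFx|² = kF².

Conversely, differentiating that quadratic along the same directions recovers the Funk equation with
C = c, hence both kinds of flatness. -/

noncomputable section

namespace FinslerGeom

variable {n : ℕ}

/-- Smoothness of `f(x, y)` for `x ∈ Ω` and `y ≠ 0`. -/
def SmoothOffZero (Ω : Set (E n)) (f : E n → E n → ℝ) : Prop :=
  ContDiffOn ℝ ∞ (fun p : E n × E n => f p.1 p.2) (Ω ×ˢ {0}ᶜ)

/-- The total derivative of `f(x, y)` in the pair `(x, y)`. -/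
def jointDeriv (f : E n → E n → ℝ) (x y : E n) : E n × E n →L[ℝ] ℝ :=
  fderiv ℝ (fun p : E n × E n => f p.1 p.2) (x, y)

lemma isOpen_slit {Ω : Set (E n)} (hΩ : IsOpen Ω) : IsOpen (Ω ×ˢ ({0}ᶜ : Set (E n))) :=
  hΩ.prod isOpen_compl_singleton

lemma slit_mem_nhds {Ω : Set (E n)} (hΩ : IsOpen Ω) {x y : E n} (hx : x ∈ Ω) (hy : y ≠ 0) :
    Ω ×ˢ ({0}ᶜ : Set (E n)) ∈ nhds (x, y) :=
  (isOpen_slit hΩ).mem_nhds ⟨hx, hy⟩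

/-! ### Calculus of functions of (x, y) off the zero section -/

section Calculus

variable {Ω : Set (E n)} {f g : E n → E n → ℝ} {x y : E n}

lemma SmoothOffZero.contDiffAt (hf : SmoothOffZero Ω f) (hΩ : IsOpen Ω) (hx : x ∈ Ω)
    (hy : y ≠ 0) : ContDiffAt ℝ ∞ (fun p : E n × E n => f p.1 p.2) (x, y) :=
  ContDiffOn.contDiffAt hf (slit_mem_nhds hΩ hx hy)

lemma SmoothOffZero.hasFDerivAt (hf : SmoothOffZero Ω f) (hΩ : IsOpen Ω) (hx : x ∈ Ω)
    (hy : y ≠ 0) : HasFDerivAt (fun p : E n × E n => f p.1 p.2) (jointDeriv f x y) (x, y) :=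
  ((hf.contDiffAt hΩ hx hy).differentiableAt (by simp)).hasFDerivAt

lemma SmoothOffZero.hasFDerivAt_left (hf : SmoothOffZero Ω f) (hΩ : IsOpen Ω) (hx : x ∈ Ω)
    (hy : y ≠ 0) :
    HasFDerivAt (fun x' => f x' y) ((jointDeriv f x y).comp (.inl ℝ (E n) (E n))) x :=
  HasFDerivAt.comp (f := fun x' => (x', y)) (g := fun p : E n × E n => f p.1 p.2) x
    (hf.hasFDerivAt hΩ hx hy) (hasFDerivAt_prodMk_left x y)

lemma SmoothOffZero.hasFDerivAt_right (hf : SmoothOffZero Ω f) (hΩ : IsOpen Ω) (hx : x ∈ Ω)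
    (hy : y ≠ 0) :
    HasFDerivAt (fun y' => f x y') ((jointDeriv f x y).comp (.inr ℝ (E n) (E n))) y :=
  HasFDerivAt.comp (f := fun y' => (x, y')) (g := fun p : E n × E n => f p.1 p.2) y
    (hf.hasFDerivAt hΩ hx hy) (hasFDerivAt_prodMk_right x y)

lemma SmoothOffZero.dx_eq (hf : SmoothOffZero Ω f) (hΩ : IsOpen Ω) (hx : x ∈ Ω)
    (hy : y ≠ 0) (i : Fin n) : dx i f x y = jointDeriv f x y (EuclideanSpace.single i 1, 0) := by
  simp [dx, (hf.hasFDerivAt_left hΩ hx hy).fderiv]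

lemma SmoothOffZero.dy_eq (hf : SmoothOffZero Ω f) (hΩ : IsOpen Ω) (hx : x ∈ Ω)
    (hy : y ≠ 0) (i : Fin n) : dy i f x y = jointDeriv f x y (0, EuclideanSpace.single i 1) := by
  simp [dy, (hf.hasFDerivAt_right hΩ hx hy).fderiv]

lemma sum_smul_single (w : E n) : ∑ i, w i • EuclideanSpace.single i (1 : ℝ) = w := by
  simpa using (EuclideanSpace.basisFun (Fin n) ℝ).sum_repr w

lemma SmoothOffZero.sum_dx (hf : SmoothOffZero Ω f) (hΩ : IsOpen Ω) (hx : x ∈ Ω)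
    (hy : y ≠ 0) (w : E n) : ∑ i, dx i f x y * w i = jointDeriv f x y (w, 0) := by
  have h : jointDeriv f x y (w, 0) = (jointDeriv f x y).comp (.inl ℝ (E n) (E n)) w := by simp
  rw [h]
  conv_rhs => rw [← sum_smul_single w]
  rw [map_sum]
  refine Finset.sum_congr rfl fun i _ => ?_
  rw [hf.dx_eq hΩ hx hy, map_smul]
  simp [mul_comm]

lemma SmoothOffZero.sum_dy (hf : SmoothOffZero Ω f) (hΩ : IsOpen Ω) (hx : x ∈ Ω)
    (hy : y ≠ 0) (w : E n) : ∑ i, dy i f x y * w i = jointDeriv f x y (0, w) := by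
  have h : jointDeriv f x y (0, w) = (jointDeriv f x y).comp (.inr ℝ (E n) (E n)) w := by simp
  rw [h]
  conv_rhs => rw [← sum_smul_single w]
  rw [map_sum]
  refine Finset.sum_congr rfl fun i _ => ?_
  rw [hf.dy_eq hΩ hx hy, map_smul]
  simp [mul_comm]

lemma SmoothOffZero.jointDeriv_apply_const (hf : SmoothOffZero Ω f) (hΩ : IsOpen Ω)
    (v : E n × E n) : SmoothOffZero Ω fun x y => jointDeriv f x y v :=
  (ContDiffOn.fderiv_of_isOpen (m := ∞) hf (isOpen_slit hΩ) (by simp)).clm_apply contDiffOn_const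

lemma SmoothOffZero.dx (hf : SmoothOffZero Ω f) (hΩ : IsOpen Ω) (i : Fin n) :
    SmoothOffZero Ω (dx i f) :=
  (hf.jointDeriv_apply_const hΩ (EuclideanSpace.single i 1, 0)).congr fun _ hp =>
    hf.dx_eq hΩ hp.1 hp.2 i

lemma SmoothOffZero.dy (hf : SmoothOffZero Ω f) (hΩ : IsOpen Ω) (i : Fin n) :
    SmoothOffZero Ω (dy i f) :=
  (hf.jointDeriv_apply_const hΩ (0, EuclideanSpace.single i 1)).congr fun _ hp =>
    hf.dy_eq hΩ hp.1 hp.2 i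

lemma smoothOffZero_coord (i : Fin n) : SmoothOffZero Ω fun _ y => y i := by
  have : ContDiff ℝ ∞ fun p : E n × E n => p.2 i := by fun_prop
  exact this.contDiffOn

lemma SmoothOffZero.mul (hf : SmoothOffZero Ω f) (hg : SmoothOffZero Ω g) :
    SmoothOffZero Ω fun x y => f x y * g x y := ContDiffOn.mul hf hg

lemma SmoothOffZero.const_mul (hf : SmoothOffZero Ω f) (c : ℝ) :
    SmoothOffZero Ω fun x y => c * f x y := ContDiffOn.mul contDiffOn_const hf

lemma SmoothOffZero.sub (hf : SmoothOffZero Ω f) (hg : SmoothOffZero Ω g) :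
    SmoothOffZero Ω fun x y => f x y - g x y := ContDiffOn.sub hf hg

lemma SmoothOffZero.pow (hf : SmoothOffZero Ω f) (m : ℕ) :
    SmoothOffZero Ω fun x y => f x y ^ m := ContDiffOn.pow hf m

lemma SmoothOffZero.sum {ι : Type*} {s : Finset ι} {f : ι → E n → E n → ℝ}
    (hf : ∀ i ∈ s, SmoothOffZero Ω (f i)) : SmoothOffZero Ω fun x y => ∑ i ∈ s, f i x y :=
  ContDiffOn.sum hf

lemma SmoothOffZero.prod {ι : Type*} {s : Finset ι} {f : ι → E n → E n → ℝ}
    (hf : ∀ i ∈ s, SmoothOffZero Ω (f i)) : SmoothOffZero Ω fun x y => ∏ i ∈ s, f i x y :=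
  contDiffOn_prod hf

lemma SmoothOffZero.inv (hf : SmoothOffZero Ω f) (h0 : ∀ x ∈ Ω, ∀ y, y ≠ 0 → f x y ≠ 0) :
    SmoothOffZero Ω fun x y => (f x y)⁻¹ :=
  ContDiffOn.inv hf fun p hp => h0 p.1 hp.1 p.2 hp.2

lemma SmoothOffZero.det {ι : Type*} [Fintype ι] [DecidableEq ι]
    {A : E n → E n → Matrix ι ι ℝ} (hA : ∀ i j, SmoothOffZero Ω fun x y => A x y i j) :
    SmoothOffZero Ω fun x y => (A x y).det := by
  simp only [Matrix.det_apply']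
  exact .sum fun σ _ => (SmoothOffZero.prod fun i _ => hA (σ i) i).const_mul _

/-- Cramer's rule: each entry is a cofactor, polynomial in the entries of A, divided by the
determinant. -/
lemma SmoothOffZero.matrix_inv {ι : Type*} [Fintype ι] [DecidableEq ι]
    {A : E n → E n → Matrix ι ι ℝ} (hA : ∀ i j, SmoothOffZero Ω fun x y => A x y i j)
    (hdet : ∀ x ∈ Ω, ∀ y, y ≠ 0 → (A x y).det ≠ 0) (i j : ι) :
    SmoothOffZero Ω fun x y => (A x y)⁻¹ i j := by
  simp only [Matrix.inv_def, Matrix.smul_apply, smul_eq_mul, Ring.inverse_eq_inv',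
    Matrix.adjugate_apply]
  refine ((SmoothOffZero.det hA).inv hdet).mul (.det fun a b => ?_)
  by_cases h : a = j
  · subst h
    simp only [Matrix.updateRow_self]
    exact contDiffOn_const
  · simp only [Matrix.updateRow_ne h]
    exact hA a b

/-- Mixed partial derivatives commute. -/
lemma SmoothOffZero.dx_dy (hf : SmoothOffZero Ω f) (hΩ : IsOpen Ω) (hx : x ∈ Ω)
    (hy : y ≠ 0) (k l : Fin n) :
    FinslerGeom.dx k (FinslerGeom.dy l f) x y = FinslerGeom.dy l (FinslerGeom.dx k f) x y := by
  have hs := (hf.contDiffAt hΩ hx hy).isSymmSndFDerivAt (by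
    rw [minSmoothness_of_isRCLikeNormedField]
    exact WithTop.coe_le_coe.2 (le_top : (2 : ℕ∞) ≤ ⊤))
  have hd : DifferentiableAt ℝ (fderiv ℝ fun p : E n × E n => f p.1 p.2) (x, y) :=
    ((hf.contDiffAt hΩ hx hy).fderiv_right (m := 1) (by
      exact WithTop.coe_le_coe.2 (le_top : (2 : ℕ∞) ≤ ⊤))).differentiableAt
      (by simp)
  -- Both iterated partials are values of the second derivative of f at a pair of constant vectors,
  -- so the symmetry of that derivative finishes.
  have key (v : E n × E n) (h : E n → E n → ℝ)
      (hh : ∀ x ∈ Ω, ∀ y, y ≠ 0 → h x y = jointDeriv f x y v) (w : E n × E n) :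
      jointDeriv h x y w = fderiv ℝ (fderiv ℝ fun p : E n × E n => f p.1 p.2) (x, y) w v := by
    have h1 : (fun p : E n × E n => h p.1 p.2) =ᶠ[nhds (x, y)] fun p => jointDeriv f p.1 p.2 v := by
      filter_upwards [slit_mem_nhds hΩ hx hy] with p hp using hh p.1 hp.1 p.2 hp.2
    rw [jointDeriv, h1.fderiv_eq]
    have h2 := hd.hasFDerivAt.clm_apply (hasFDerivAt_const v (x, y))
    unfold jointDeriv
    rw [h2.fderiv]
    simp
  rw [(hf.dy hΩ l).dx_eq hΩ hx hy, (hf.dx hΩ k).dy_eq hΩ hx hy,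
    key _ _ (fun x hx y hy => hf.dy_eq hΩ hx hy l), key _ _ (fun x hx y hy => hf.dx_eq hΩ hx hy k)]
  exact hs _ _

/-- Euler's identity for positively homogeneous functions. -/
lemma SmoothOffZero.euler (hf : SmoothOffZero Ω f) (hΩ : IsOpen Ω) (hx : x ∈ Ω)
    (hy : y ≠ 0) {d : ℕ} (hom : ∀ t : ℝ, 0 < t → f x (t • y) = t ^ d * f x y) :
    jointDeriv f x y (0, y) = d * f x y := by
  have h1 : HasDerivAt (fun t : ℝ => f x (t • y)) (jointDeriv f x y (0, y)) 1 := by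
    have h2 : HasDerivAt (fun t : ℝ => t • y) y 1 := by
      simpa using (hasDerivAt_id (1 : ℝ)).smul_const y
    have h3 := hf.hasFDerivAt_right hΩ hx hy
    rw [show y = (1 : ℝ) • y by simp] at h3
    have h5 := HasFDerivAt.comp_hasDerivAt (f := fun t : ℝ => t • y) (l := fun y' => f x y')
      (1 : ℝ) h3 h2
    rw [one_smul] at h5
    exact h5
  have h4 : HasDerivAt (fun t : ℝ => t ^ d * f x y) (d * f x y) 1 := by
    simpa using (hasDerivAt_pow d (1 : ℝ)).mul_const (f x y)
  refine h1.unique (h4.congr_of_eventuallyEq ?_)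
  filter_upwards [lt_mem_nhds one_pos] with t ht using hom t ht

/-- The derivative of `f(x, y)` along a curve. -/
lemma SmoothOffZero.hasDerivAt_comp (hf : SmoothOffZero Ω f) (hΩ : IsOpen Ω) {a b : ℝ → E n}
    {a' b' : E n} {t : ℝ} (hx : a t ∈ Ω) (hy : b t ≠ 0) (ha : HasDerivAt a a' t)
    (hb : HasDerivAt b b' t) :
    HasDerivAt (fun s => f (a s) (b s)) (jointDeriv f (a t) (b t) (a', b')) t :=
  HasFDerivAt.comp_hasDerivAt (f := fun s => (a s, b s)) (l := fun p : E n × E n => f p.1 p.2) t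
    (hf.hasFDerivAt hΩ hx hy) (ha.prodMk hb)

lemma jointDeriv_apply_mk (f : E n → E n → ℝ) (x y v w : E n) :
    jointDeriv f x y (v, w) = jointDeriv f x y (v, 0) + jointDeriv f x y (0, w) := by
  rw [← map_add]; simp

/-- The function `[f]_{xᵏ} yᵏ`. -/
def horizontal (f : E n → E n → ℝ) (x y : E n) : ℝ := ∑ k, dx k f x y * y k

lemma SmoothOffZero.horizontal (hf : SmoothOffZero Ω f) (hΩ : IsOpen Ω) :
    SmoothOffZero Ω (horizontal f) :=
  .sum fun k _ => (hf.dx hΩ k).mul (smoothOffZero_coord k)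

lemma SmoothOffZero.dy_horizontal (hf : SmoothOffZero Ω f) (hΩ : IsOpen Ω) (hx : x ∈ Ω)
    (hy : y ≠ 0) (l : Fin n) :
    FinslerGeom.dy l (FinslerGeom.horizontal f) x y =
      ∑ k, FinslerGeom.dx k (FinslerGeom.dy l f) x y * y k + FinslerGeom.dx l f x y := by
  have h (k : Fin n) := ((hf.dx hΩ k).hasFDerivAt_right hΩ hx hy).mul
    ((EuclideanSpace.proj k : E n →L[ℝ] ℝ).hasFDerivAt (x := y))
  have h2 := (HasFDerivAt.fun_sum fun k (_ : k ∈ Finset.univ) => h k).fderiv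
  have h3 : FinslerGeom.dy l (FinslerGeom.horizontal f) x y = _ :=
    congrArg (fun A => A (EuclideanSpace.single l (1 : ℝ))) h2
  rw [h3, _root_.sum_apply]
  simp only [_root_.add_apply, _root_.smul_apply, smul_eq_mul,
    ContinuousLinearMap.comp_apply, ContinuousLinearMap.inr_apply, Finset.sum_add_distrib]
  rw [add_comm]
  congr 1
  · refine Finset.sum_congr rfl fun k _ => ?_
    rw [hf.dx_dy hΩ hx hy, (hf.dx hΩ k).dy_eq hΩ hx hy]
    simp [mul_comm]
  · simp

/-- The gradient in `y` of a positively homogeneous function of degree `d`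
satisfies the derivative of Euler's identity. -/
lemma SmoothOffZero.sum_dy_dy (hf : SmoothOffZero Ω f) (hΩ : IsOpen Ω) (hx : x ∈ Ω)
    (hy : y ≠ 0) {d : ℕ}
    (hom : ∀ x ∈ Ω, ∀ y, y ≠ 0 → ∀ t : ℝ, 0 < t → f x (t • y) = t ^ d * f x y) (i : Fin n) :
    ∑ j, FinslerGeom.dy i (FinslerGeom.dy j f) x y * y j = (d - 1) * FinslerGeom.dy i f x y := by
  have h (k : Fin n) := ((hf.dy hΩ k).hasFDerivAt_right hΩ hx hy).mul
    ((EuclideanSpace.proj k : E n →L[ℝ] ℝ).hasFDerivAt (x := y))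
  have h2 := (HasFDerivAt.fun_sum fun k (_ : k ∈ Finset.univ) => h k)
  have h3 : (fun y' => ∑ k, FinslerGeom.dy k f x y' * y' k) =ᶠ[nhds y] fun y' => d * f x y' := by
    filter_upwards [isOpen_compl_singleton.mem_nhds hy] with y' hy'
    rw [hf.sum_dy hΩ hx hy', hf.euler hΩ hx hy' (hom x hx y' hy')]
  have h4 := (((hf.hasFDerivAt_right hΩ hx hy).const_mul (d : ℝ)).congr_of_eventuallyEq h3).unique
    h2
  have h5 := congrArg (fun A => A (EuclideanSpace.single i (1 : ℝ))) h4
  rw [_root_.sum_apply] at h5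
  simp only [_root_.add_apply, _root_.smul_apply, smul_eq_mul,
    ContinuousLinearMap.comp_apply, ContinuousLinearMap.inr_apply, Finset.sum_add_distrib] at h5
  simp only [← hf.dy_eq hΩ hx hy, ← (hf.dy hΩ _).dy_eq hΩ hx hy] at h5
  simp only [PiLp.proj_apply, PiLp.single_apply, mul_ite, mul_one, mul_zero, Finset.sum_ite_eq',
    Finset.mem_univ, if_true] at h5
  have h6 : ∑ j, FinslerGeom.dy i (FinslerGeom.dy j f) x y * y j =
      ∑ j, y j * FinslerGeom.dy i (FinslerGeom.dy j f) x y :=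
    Finset.sum_congr rfl fun j _ => mul_comm _ _
  rw [h6]
  linarith

end Calculus

/-! ### Radial sprays and the Funk equation -/

section Spray

open Matrix

variable {Ω : Set (E n)} {F : E n → E n → ℝ} {x y : E n}

lemma IsFinslerMetric.smoothOffZero (hF : IsFinslerMetric Ω F) : SmoothOffZero Ω F := hF.smooth

lemma IsFinslerMetric.smoothOffZero_squared (hF : IsFinslerMetric Ω F) :
    SmoothOffZero Ω (squared F) := hF.smoothOffZero.pow 2

lemma IsFinslerMetric.euler (hF : IsFinslerMetric Ω F) (hΩ : IsOpen Ω) (hx : x ∈ Ω)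
    (hy : y ≠ 0) : jointDeriv F x y (0, y) = F x y := by
  simpa using hF.smoothOffZero.euler hΩ hx hy (d := 1)
    (fun t ht => by simpa using hF.homog x hx y t ht)

lemma IsFinslerMetric.squared_homog (hF : IsFinslerMetric Ω F) (hx : x ∈ Ω) (y : E n) {t : ℝ}
    (ht : 0 < t) : squared F x (t • y) = t ^ 2 * squared F x y := by
  simp only [squared, hF.homog x hx y t ht]; ring

lemma SmoothOffZero.jointDeriv_pow (hF : SmoothOffZero Ω F) (hΩ : IsOpen Ω) (hx : x ∈ Ω)
    (hy : y ≠ 0) (m : ℕ) (v : E n × E n) :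
    jointDeriv (fun x y => F x y ^ m) x y v = m * F x y ^ (m - 1) * jointDeriv F x y v := by
  have h := ((hF.hasFDerivAt hΩ hx hy).pow m).fderiv
  unfold jointDeriv at h ⊢
  rw [h]
  simp

lemma IsFinslerMetric.jointDeriv_squared (hF : IsFinslerMetric Ω F) (hΩ : IsOpen Ω) (hx : x ∈ Ω)
    (hy : y ≠ 0) (v : E n × E n) :
    jointDeriv (squared F) x y v = 2 * F x y * jointDeriv F x y v := by
  have h := hF.smoothOffZero.jointDeriv_pow hΩ hx hy 2 v
  norm_num at h
  exact h

lemma IsFinslerMetric.isUnit_det (hF : IsFinslerMetric Ω F) (hx : x ∈ Ω) (hy : y ≠ 0) :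
    IsUnit (fundamentalTensor F x y).det :=
  (hF.posDef x hx y hy).det_pos.ne'.isUnit

/-- Since F² has degree 2, its y-gradient has degree 1, and Euler's identity gives g y = ½ [F²]_y.
This exchanges radial vectors for multiples of F_y. -/
lemma IsFinslerMetric.fundamentalTensor_mulVec (hF : IsFinslerMetric Ω F) (hΩ : IsOpen Ω)
    (hx : x ∈ Ω) (hy : y ≠ 0) :
    fundamentalTensor F x y *ᵥ y.ofLp = fun i => F x y * dy i F x y := by
  ext i
  have h := hF.smoothOffZero_squared.sum_dy_dy hΩ hx hy (d := 2)
    (fun x hx y _ t ht => hF.squared_homog hx y ht) i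
  simp only [mulVec, dotProduct, fundamentalTensor, of_apply, mul_assoc, ← Finset.mul_sum]
  rw [h, hF.smoothOffZero_squared.dy_eq hΩ hx hy, hF.jointDeriv_squared hΩ hx hy,
    hF.smoothOffZero.dy_eq hΩ hx hy]
  push_cast
  ring

lemma IsFinslerMetric.inv_mulVec_dy (hF : IsFinslerMetric Ω F) (hΩ : IsOpen Ω)
    (hx : x ∈ Ω) (hy : y ≠ 0) :
    (fundamentalTensor F x y)⁻¹ *ᵥ (fun i => F x y * dy i F x y) = y.ofLp := by
  rw [← hF.fundamentalTensor_mulVec hΩ hx hy, mulVec_mulVec,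
    nonsing_inv_mul _ (hF.isUnit_det hx hy), one_mulVec]

/-- The y^l-derivative of [F²]_{x^k} y^k contains one extra [F²]_{x^l}, whence the factor 2. -/
lemma IsFinslerMetric.spray_eq (hF : IsFinslerMetric Ω F) (hΩ : IsOpen Ω)
    (hx : x ∈ Ω) (hy : y ≠ 0) :
    (spray F x y).ofLp = (1 / 4 : ℝ) • ((fundamentalTensor F x y)⁻¹ *ᵥ fun l =>
      dy l (horizontal (squared F)) x y - 2 * dx l (squared F) x y) := by
  ext i
  simp only [spray, Pi.smul_apply, smul_eq_mul, mulVec, dotProduct]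
  congr 1
  refine Finset.sum_congr rfl fun l _ => ?_
  rw [hF.smoothOffZero_squared.dy_horizontal hΩ hx hy]
  ring

lemma IsFinslerMetric.smoothOffZero_spray (hF : IsFinslerMetric Ω F) (hΩ : IsOpen Ω)
    (i : Fin n) : SmoothOffZero Ω fun x y => spray F x y i := by
  have hL := hF.smoothOffZero_squared
  refine (SmoothOffZero.sum fun l _ => ?_).const_mul _
  refine (SmoothOffZero.matrix_inv (fun a b => ?_) (fun x hx y hy => ?_) i l).mul
    ((SmoothOffZero.sum fun k _ => ((hL.dy hΩ l).dx hΩ k).mul (smoothOffZero_coord k)).sub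
      (hL.dx hΩ l))
  · exact ((hL.dy hΩ b).dy hΩ a).const_mul _
  · exact (hF.posDef x hx y hy).det_pos.ne'

/-- A metric satisfying `F_{xˡ} = C F F_{yˡ}` has spray coefficients `½ C F yⁱ`. -/
lemma IsFinslerMetric.spray_eq_of_funk (hF : IsFinslerMetric Ω F) (hΩ : IsOpen Ω)
    (hx : x ∈ Ω) (hy : y ≠ 0) {C : ℝ}
    (hC : ∀ y, y ≠ 0 → ∀ w, jointDeriv F x y (w, 0) = C * F x y * jointDeriv F x y (0, w)) :
    spray F x y = (C / 2 * F x y) • y := by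
  have hL := hF.smoothOffZero_squared
  have hdx (y : E n) (hy : y ≠ 0) (w : E n) :
      jointDeriv (squared F) x y (w, 0) = 2 * C * F x y ^ 2 * jointDeriv F x y (0, w) := by
    rw [hF.jointDeriv_squared hΩ hx hy, hC y hy]; ring
  have hhor : (fun y => horizontal (squared F) x y) =ᶠ[nhds y] fun y => 2 * C * F x y ^ 3 := by
    filter_upwards [isOpen_compl_singleton.mem_nhds hy] with y hy
    rw [horizontal, hL.sum_dx hΩ hx hy, hdx y hy, hF.euler hΩ hx hy]; ring
  have hdy (l : Fin n) :
      dy l (horizontal (squared F)) x y = 6 * C * F x y ^ 2 * dy l F x y := by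
    rw [hF.smoothOffZero.dy_eq hΩ hx hy]
    have h := (((hF.smoothOffZero.hasFDerivAt_right hΩ hx hy).pow 3).const_mul
      (2 * C)).congr_of_eventuallyEq hhor
    simp only [dy, h.fderiv]
    simp
    ring
  -- 6CF² F_y - 4CF² F_y = 2CF · (F F_y), and g⁻¹ sends F F_y to y.
  have hA : (fun l => dy l (horizontal (squared F)) x y - 2 * dx l (squared F) x y) =
      (2 * C * F x y) • fun l => F x y * dy l F x y := by
    ext l
    rw [hdy, hL.dx_eq hΩ hx hy, hdx y hy, ← hF.smoothOffZero.dy_eq hΩ hx hy, Pi.smul_apply,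
      smul_eq_mul]
    ring
  ext i
  rw [hF.spray_eq hΩ hx hy, hA, mulVec_smul, hF.inv_mulVec_dy hΩ hx hy]
  simp
  ring

/-- If the spray coefficients are `½ C F yⁱ` at a point, then `F_{xˡ} = C F F_{yˡ}` there. -/
lemma IsFinslerMetric.funk_of_spray_eq (hF : IsFinslerMetric Ω F) (hΩ : IsOpen Ω)
    (hx : x ∈ Ω) {C : ℝ} (hC : ∀ y, y ≠ 0 → spray F x y = (C / 2 * F x y) • y)
    (hy : y ≠ 0) (w : E n) :
    jointDeriv F x y (w, 0) = C * F x y * jointDeriv F x y (0, w) := by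
  have hL := hF.smoothOffZero_squared
  have hA (y : E n) (hy : y ≠ 0) (l : Fin n) :
      dy l (horizontal (squared F)) x y - 2 * dx l (squared F) x y =
        2 * C * F x y ^ 2 * dy l F x y := by
    have h1 := hF.spray_eq hΩ hx hy
    have h2 := congrArg (fun v => fundamentalTensor F x y *ᵥ v) h1
    simp only at h2
    rw [mulVec_smul, mulVec_mulVec, mul_nonsing_inv _ (hF.isUnit_det hx hy), one_mulVec,
      hC y hy, WithLp.ofLp_smul, mulVec_smul, hF.fundamentalTensor_mulVec hΩ hx hy] at h2
    have h3 := congrFun h2 l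
    simp only [Pi.smul_apply, smul_eq_mul] at h3
    linarith
  have hA' (y : E n) (hy : y ≠ 0) (w : E n) :
      jointDeriv (horizontal (squared F)) x y (0, w) - 2 * jointDeriv (squared F) x y (w, 0) =
        2 * C * F x y ^ 2 * jointDeriv F x y (0, w) := by
    rw [← (hL.horizontal hΩ).sum_dy hΩ hx hy, ← hL.sum_dx hΩ hx hy,
      ← hF.smoothOffZero.sum_dy hΩ hx hy, Finset.mul_sum, Finset.mul_sum,
      ← Finset.sum_sub_distrib]
    refine Finset.sum_congr rfl fun l _ => ?_
    linear_combination w l * hA y hy l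
  -- Contract `hA'` with y: `horizontal (squared F)` has degree 3 in y, so the left side is 3 - 2 =
  -- 1 times it. Differentiating the result in y then isolates F_x in `hA'`.
  have hhor (y : E n) (hy : y ≠ 0) : horizontal (squared F) x y = 2 * C * F x y ^ 3 := by
    have hom (t : ℝ) (ht : 0 < t) :
        horizontal (squared F) x (t • y) = t ^ 3 * horizontal (squared F) x y := by
      have hty : t • y ≠ 0 := smul_ne_zero ht.ne' hy
      have h1 : (fun x' => squared F x' (t • y)) =ᶠ[nhds x] fun x' => t ^ 2 * squared F x' y := by
        filter_upwards [hΩ.mem_nhds hx] with x' hx' using hF.squared_homog hx' y ht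
      have h2 := ((hL.hasFDerivAt_left hΩ hx hy).const_mul (t ^ 2)).congr_of_eventuallyEq h1
      have h3 := congrArg (fun A => A y) (h2.unique (hL.hasFDerivAt_left hΩ hx hty))
      rw [horizontal, horizontal, hL.sum_dx hΩ hx hy, hL.sum_dx hΩ hx hty]
      simp at h3
      have h4 : jointDeriv (squared F) x (t • y) (t • y, 0) =
          t * jointDeriv (squared F) x (t • y) (y, 0) := by
        rw [← smul_eq_mul, ← map_smul]; simp
      rw [h4, ← h3]
      ring
    have h1 := (hL.horizontal hΩ).euler hΩ hx hy (d := 3) hom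
    have h2 := hA' y hy y
    have h3 : jointDeriv (squared F) x y (y, 0) = horizontal (squared F) x y := by
      rw [horizontal, hL.sum_dx hΩ hx hy]
    rw [h1, h3, hF.euler hΩ hx hy] at h2
    push_cast at h2
    linarith
  have hdy : jointDeriv (horizontal (squared F)) x y (0, w) =
      6 * C * F x y ^ 2 * jointDeriv F x y (0, w) := by
    have h1 : (fun y => horizontal (squared F) x y) =ᶠ[nhds y] fun y => 2 * C * F x y ^ 3 := by
      filter_upwards [isOpen_compl_singleton.mem_nhds hy] with y hy using hhor y hy
    have h := (((hF.smoothOffZero.hasFDerivAt_right hΩ hx hy).pow 3).const_mul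
      (2 * C)).congr_of_eventuallyEq h1
    have h2 := congrArg (fun A => A w) (((hL.horizontal hΩ).hasFDerivAt_right hΩ hx hy).unique h)
    simp at h2
    rw [h2]
    ring
  have h := hA' y hy w
  rw [hdy, hF.jointDeriv_squared hΩ hx hy] at h
  have hpos := hF.pos x hx y hy
  refine mul_left_cancel₀ (mul_ne_zero four_ne_zero hpos.ne') ?_
  linarith

end Spray

/-! ### Straight geodesics and radial sprays -/

section Geodesics

variable {Ω : Set (E n)} {F : E n → E n → ℝ} {x y : E n}

/-- Short-time existence of geodesics. -/
lemma IsFinslerMetric.exists_geodesic (hF : IsFinslerMetric Ω F) (hΩ : IsOpen Ω)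
    (hx : x ∈ Ω) (hy : y ≠ 0) :
    ∃ (γ : ℝ → E n) (I : Set ℝ), IsGeodesicOn Ω F γ I ∧ 0 ∈ I ∧ γ 0 = x ∧ deriv γ 0 = y := by
  -- Picard–Lindelöf for the first-order system x' = y, y' = -2G(x, y). The interval is later shrunk
  -- so that the solution stays in Ω with nonzero velocity.
  have hs : ContDiffAt ℝ 1 (fun p : E n × E n => (p.2, -((2 : ℝ) • spray F p.1 p.2))) (x, y) := by
    have h : ContDiffAt ℝ 1 (fun p : E n × E n => spray F p.1 p.2) (x, y) := by
      rw [contDiffAt_euclidean]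
      exact fun i => ((hF.smoothOffZero_spray hΩ i).contDiffAt hΩ hx hy).of_le
        (WithTop.coe_le_coe.2 (le_top : (1 : ℕ∞) ≤ ⊤))
    fun_prop
  obtain ⟨r, hr, ε, hε, H⟩ :=
    hs.exists_forall_mem_closedBall_exists_eq_forall_mem_Ioo_hasDerivAt 0
  obtain ⟨α, hα0, hα⟩ := H (x, y) (Metric.mem_closedBall_self hr.le)
  have hcont : ContinuousAt α 0 := (hα 0 (by simp [hε])).continuousAt
  have hU : ∀ᶠ t in nhds (0 : ℝ), α t ∈ Ω ×ˢ ({0}ᶜ : Set (E n)) :=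
    hcont.eventually_mem (by rw [hα0]; exact slit_mem_nhds hΩ hx hy)
  obtain ⟨δ, hδ, hδU⟩ := Metric.eventually_nhds_iff.1 hU
  set I : Set ℝ := Set.Ioo (-min ε δ) (min ε δ)
  have hpos : 0 < min ε δ := lt_min hε hδ
  have hIε (t : ℝ) (ht : t ∈ I) : t ∈ Set.Ioo (0 - ε) (0 + ε) := by
    have := min_le_left ε δ
    exact ⟨by linarith [ht.1], by linarith [ht.2]⟩
  have hIU (t : ℝ) (ht : t ∈ I) : α t ∈ Ω ×ˢ ({0}ᶜ : Set (E n)) := by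
    have := min_le_right ε δ
    refine hδU ?_
    rw [Real.dist_eq, sub_zero, abs_lt]
    exact ⟨by linarith [ht.1], by linarith [ht.2]⟩
  have h1 (t : ℝ) (ht : t ∈ I) : HasDerivAt (fun s => (α s).1) (α t).2 t :=
    (hasFDerivAt_fst (𝕜 := ℝ) (E := E n) (F := E n)).comp_hasDerivAt (f := α) t (hα t (hIε t ht))
  have h2 (t : ℝ) (ht : t ∈ I) :
      HasDerivAt (fun s => (α s).2) (-((2 : ℝ) • spray F (α t).1 (α t).2)) t :=
    (hasFDerivAt_snd (𝕜 := ℝ) (E := E n) (F := E n)).comp_hasDerivAt (f := α) t (hα t (hIε t ht))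
  have h0 : (0 : ℝ) ∈ I := ⟨by linarith, hpos⟩
  refine ⟨fun s => (α s).1, I, ⟨isOpen_Ioo, Set.ordConnected_Ioo, fun t ht => (hIU t ht).1,
    fun t ht => (h1 t ht).differentiableAt, fun t ht => ?_, fun t ht => ?_⟩, h0, by simp [hα0], ?_⟩
  · rw [(h1 t ht).deriv]
    exact (hIU t ht).2
  · rw [(h1 t ht).deriv]
    refine (h2 t ht).congr_of_eventuallyEq ?_
    filter_upwards [isOpen_Ioo.mem_nhds ht] with s hs using (h1 s hs).deriv
  · rw [(h1 0 h0).deriv, hα0]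

/-- Straight geodesics force the spray to be radial. -/
lemma IsProjectivelyFlat.spray_eq_smul (h : IsProjectivelyFlat Ω F) (hF : IsFinslerMetric Ω F)
    (hΩ : IsOpen Ω) (hx : x ∈ Ω) (hy : y ≠ 0) : ∃ P : ℝ, spray F x y = P • y := by
  obtain ⟨γ, I, hγ, h0, hγ0, hγ'⟩ := hF.exists_geodesic hΩ hx hy
  obtain ⟨v, hv⟩ := (collinear_iff_of_mem (Set.mem_image_of_mem γ h0)).1 (h γ I hγ)
  -- Collinearity is differentiated twice: a vector orthogonal to the line is orthogonal to γ', then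
  -- to γ'' = -2G. So y and G both lie on the line through v.
  have hperp (w : E n) (hw : inner ℝ w v = 0) : ∀ t ∈ I, inner ℝ w (deriv γ t) = 0 := by
    intro t ht
    have h1 : HasDerivAt (fun s => inner ℝ w (γ s)) (inner ℝ w (deriv γ t)) t := by
      simpa using (hasDerivAt_const t w).inner ℝ (hγ.differentiableAt t ht).hasDerivAt
    have h2 : HasDerivAt (fun s => inner ℝ w (γ s)) 0 t := by
      refine (hasDerivAt_const t (inner ℝ w (γ 0))).congr_of_eventuallyEq ?_
      filter_upwards [hγ.isOpen.mem_nhds ht] with s hs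
      obtain ⟨r, hr⟩ := hv (γ s) (Set.mem_image_of_mem γ hs)
      simp [hr, inner_add_right, inner_smul_right, hw]
    exact h1.unique h2
  have hperp' (w : E n) (hw : inner ℝ w v = 0) : inner ℝ w (spray F x y) = 0 := by
    have h1 : HasDerivAt (fun s => inner ℝ w (deriv γ s))
        (inner ℝ w (-((2 : ℝ) • spray F (γ 0) (deriv γ 0)))) 0 := by
      simpa using (hasDerivAt_const (0 : ℝ) w).inner ℝ (hγ.equation 0 h0)
    have h2 : HasDerivAt (fun s => inner ℝ w (deriv γ s)) 0 0 := by
      refine (hasDerivAt_const (0 : ℝ) (0 : ℝ)).congr_of_eventuallyEq ?_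
      filter_upwards [hγ.isOpen.mem_nhds h0] with s hs using hperp w hw s hs
    have h3 := h1.unique h2
    rw [hγ0, hγ', inner_neg_right, inner_smul_right] at h3
    linarith
  have hspan (u : E n) (hu : ∀ w : E n, inner ℝ w v = 0 → inner ℝ w u = 0) :
      ∃ a : ℝ, a • v = u := by
    rw [← Submodule.mem_span_singleton, ← Submodule.orthogonal_orthogonal (Submodule.span ℝ {v})]
    exact fun w hw => hu w (Submodule.mem_orthogonal_singleton_iff_inner_left.1 hw)
  obtain ⟨a, ha⟩ := hspan y fun w hw => hγ' ▸ hperp w hw 0 h0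
  obtain ⟨b, hb⟩ := hspan (spray F x y) hperp'
  have ha0 : a ≠ 0 := by
    rintro rfl
    exact hy (by simpa using ha.symm)
  refine ⟨b / a, ?_⟩
  rw [← hb, ← ha, smul_smul, div_mul_cancel₀ b ha0]

/-- A radial spray has straight geodesics. -/
lemma isProjectivelyFlat_of_spray_eq_smul
    (h : ∀ x ∈ Ω, ∀ y, y ≠ 0 → ∃ P : ℝ, spray F x y = P • y) : IsProjectivelyFlat Ω F := by
  intro γ I hγ
  rcases I.eq_empty_or_nonempty with rfl | ⟨t₀, ht₀⟩
  · simpa using collinear_empty ℝ (E n)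
  have hI : IsPreconnected I := hγ.ordConnected.isPreconnected
  rw [collinear_iff_of_mem (Set.mem_image_of_mem γ ht₀)]
  refine ⟨deriv γ t₀, ?_⟩
  rintro _ ⟨t, ht, rfl⟩
  have hvel (w : E n) (hw : inner ℝ w (deriv γ t₀) = 0) (s : ℝ) (hs : s ∈ I) :
      inner ℝ w (deriv γ s) = 0 := by
    -- As γ'' = -2Pγ', numerator and denominator both have logarithmic rate -4P, which cancels. P is
    -- known only pointwise, and this quotient avoids integrating it along γ.
    have hd (s : ℝ) (hs : s ∈ I) : HasDerivAt
        (fun s => inner ℝ w (deriv γ s) ^ 2 / inner ℝ (deriv γ s) (deriv γ s)) 0 s := by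
      obtain ⟨P, hP⟩ := h _ (hγ.mem s hs) _ (hγ.deriv_ne_zero s hs)
      have h2 := hγ.equation s hs
      have hne : inner ℝ (deriv γ s) (deriv γ s) ≠ 0 := by
        simpa using hγ.deriv_ne_zero s hs
      have h3 := (((hasDerivAt_const s w).inner ℝ h2).pow 2).div (h2.inner ℝ h2) hne
      refine h3.congr_deriv ?_
      rw [hP]
      simp only [inner_neg_right, inner_neg_left, inner_smul_right, inner_smul_left, inner_zero_left]
      simp
      left
      ring
    have h4 := hγ.isOpen.is_const_of_deriv_eq_zero hI
      (fun s hs => (hd s hs).differentiableAt.differentiableWithinAt)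
      (fun s hs => (hd s hs).deriv) hs ht₀
    have hne : inner ℝ (deriv γ s) (deriv γ s) ≠ 0 := by
      simpa using hγ.deriv_ne_zero s hs
    simp only [hw] at h4
    simpa [hne, hγ.deriv_ne_zero s hs] using h4
  have hpos (w : E n) (hw : inner ℝ w (deriv γ t₀) = 0) : inner ℝ w (γ t - γ t₀) = 0 := by
    have hd (s : ℝ) (hs : s ∈ I) : HasDerivAt (fun s => inner ℝ w (γ s)) 0 s := by
      have := (hasDerivAt_const s w).inner ℝ (hγ.differentiableAt s hs).hasDerivAt
      simpa [hvel w hw s hs] using this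
    rw [inner_sub_right, sub_eq_zero]
    exact hγ.isOpen.is_const_of_deriv_eq_zero hI
      (fun s hs => (hd s hs).differentiableAt.differentiableWithinAt)
      (fun s hs => (hd s hs).deriv) ht ht₀
  have hmem : γ t - γ t₀ ∈ Submodule.span ℝ {deriv γ t₀} := by
    rw [← Submodule.orthogonal_orthogonal (Submodule.span ℝ {deriv γ t₀})]
    exact fun w hw => hpos w (Submodule.mem_orthogonal_singleton_iff_inner_left.1 hw)
  obtain ⟨r, hr⟩ := Submodule.mem_span_singleton.1 hmem
  exact ⟨r, by rw [hr]; simp⟩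

end Geodesics

/-! ### The dual potential is a multiple of F³ -/

section DuallyFlat

open Matrix

variable {Ω : Set (E n)} {F : E n → E n → ℝ} {x y : E n}

/-- Turns a vanishing y-derivative into independence of y; on a line the two rays could carry
different constants. -/
lemma isConnected_compl_zero (hn : 2 ≤ n) : IsConnected ({0}ᶜ : Set (E n)) := by
  refine isConnected_compl_singleton_of_one_lt_rank ?_ 0
  rw [← Module.finrank_eq_rank]
  simp
  omega

/-- A Finsler metric with radial spray that is dually flat has spray coefficients
`½ C(x) F yⁱ` with `C` smooth. -/
lemma IsDuallyFlat.exists_spray_eq (hn : 2 ≤ n) (hd : IsDuallyFlat Ω F)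
    (hF : IsFinslerMetric Ω F) (hΩ : IsOpen Ω)
    (hP : ∀ x ∈ Ω, ∀ y, y ≠ 0 → ∃ P : ℝ, spray F x y = P • y) :
    ∃ C : E n → ℝ, ContDiffOn ℝ ∞ C Ω ∧
      ∀ x ∈ Ω, ∀ y, y ≠ 0 → spray F x y = (C x / 2 * F x y) • y := by
  obtain ⟨H, hHs, hHh, hH⟩ := hd
  replace hHs : SmoothOffZero Ω H := hHs
  obtain ⟨y₀, hy₀⟩ := (isConnected_compl_zero hn).nonempty
  have hgrad {x : E n} (hx : x ∈ Ω) {y : E n} (hy : y ≠ 0) {P : ℝ} (hP : spray F x y = P • y)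
      (w : E n) : jointDeriv H x y (0, w) = -2 * P * F x y * jointDeriv F x y (0, w) := by
    have h1 : P • y.ofLp = (-(1 / 2 : ℝ)) • ((fundamentalTensor F x y)⁻¹ *ᵥ fun j => dy j H x y) := by
      ext i
      have := hH x hx y hy i
      rw [hP] at this
      simpa [mulVec, dotProduct] using this
    have h2 := congrArg (fun v => fundamentalTensor F x y *ᵥ v) h1
    simp only at h2
    rw [mulVec_smul, mulVec_smul, hF.fundamentalTensor_mulVec hΩ hx hy, mulVec_mulVec,
      mul_nonsing_inv _ (hF.isUnit_det hx hy), one_mulVec] at h2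
    rw [← hHs.sum_dy hΩ hx hy, ← hF.smoothOffZero.sum_dy hΩ hx hy, Finset.mul_sum]
    refine Finset.sum_congr rfl fun j _ => ?_
    have h3 := congrFun h2 j
    simp only [Pi.smul_apply, smul_eq_mul] at h3
    linear_combination (2 * w j) * h3
  have hPH {x : E n} (hx : x ∈ Ω) {y : E n} (hy : y ≠ 0) {P : ℝ} (hP : spray F x y = P • y) :
      3 * H x y = -2 * P * F x y ^ 2 := by
    have h1 := hgrad hx hy hP y
    rw [hF.euler hΩ hx hy, hHs.euler hΩ hx hy (d := 3) (hHh x hx y hy)] at h1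
    push_cast at h1
    linarith
  -- `hgrad` and `hPH` together give F H_y = 3H F_y, so H/F³ has zero y-derivative.
  have hconst {x : E n} (hx : x ∈ Ω) {y : E n} (hy : y ≠ 0) :
      H x y * (F x y ^ 3)⁻¹ = H x y₀ * (F x y₀ ^ 3)⁻¹ := by
    have hdv (y : E n) (hy : y ≠ 0) :
        HasFDerivAt (fun y => H x y * (F x y ^ 3)⁻¹) (0 : E n →L[ℝ] ℝ) y := by
      obtain ⟨P, hP⟩ := hP x hx y hy
      have hpos := hF.pos x hx y hy
      have h1 := hHs.hasFDerivAt_right hΩ hx hy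
      have h2 := (hF.smoothOffZero.hasFDerivAt_right hΩ hx hy).pow 3
      have h3 := h1.mul ((hasDerivAt_inv (pow_pos hpos 3).ne').comp_hasFDerivAt y h2)
      refine h3.congr_fderiv ?_
      ext w
      have h4 := hgrad hx hy hP w
      have h5 := hPH hx hy hP
      simp
      rw [h4]
      field_simp
      linear_combination (-jointDeriv F x y (0, w)) * h5
    exact isOpen_compl_singleton.is_const_of_fderiv_eq_zero (𝕜 := ℝ)
      (isConnected_compl_zero hn).isPreconnected
      (fun y hy => (hdv y hy).differentiableAt.differentiableWithinAt)
      (fun y hy => (hdv y hy).fderiv) hy hy₀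
  -- Solve 3H = -2PF² with P = ½CF. Evaluating at the fixed y₀ makes C visibly smooth in x.
  refine ⟨fun x => -3 * (H x y₀ * (F x y₀ ^ 3)⁻¹), ?_, fun x hx y hy => ?_⟩
  · have h1 : SmoothOffZero Ω fun x y => -3 * (H x y * (F x y ^ 3)⁻¹) :=
      (hHs.mul ((hF.smoothOffZero.pow 3).inv fun x hx y hy =>
        (pow_pos (hF.pos x hx y hy) 3).ne')).const_mul _
    exact ContDiffOn.comp (f := fun x => (x, y₀))
      (g := fun p : E n × E n => -3 * (H p.1 p.2 * (F p.1 p.2 ^ 3)⁻¹)) h1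
      (by fun_prop) (fun x hx => ⟨hx, hy₀⟩)
  · obtain ⟨P, hP⟩ := hP x hx y hy
    simp only
    rw [hP, ← hconst hx hy]
    congr 1
    have hpos := hF.pos x hx y hy
    have := hPH hx hy hP
    field_simp
    linarith

/-- A metric satisfying `F_{xˡ} = c F F_{yˡ}` is dually flat, with potential `-(c/3) F³`. -/
lemma IsFinslerMetric.isDuallyFlat_of_funk (hF : IsFinslerMetric Ω F) (hΩ : IsOpen Ω) {c : ℝ}
    (hc : ∀ x ∈ Ω, ∀ y, y ≠ 0 → ∀ w,
      jointDeriv F x y (w, 0) = c * F x y * jointDeriv F x y (0, w)) : IsDuallyFlat Ω F := by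
  have hH : SmoothOffZero Ω fun x y => -(c / 3) * F x y ^ 3 := (hF.smoothOffZero.pow 3).const_mul _
  refine ⟨fun x y => -(c / 3) * F x y ^ 3, hH, fun x hx y hy t ht => ?_, fun x hx y hy i => ?_⟩
  · simp only [hF.homog x hx y t ht]; ring
  · have h1 : (fun j => dy j (fun x y => -(c / 3) * F x y ^ 3) x y) =
        (-(c * F x y)) • fun j => F x y * dy j F x y := by
      ext j
      have h := (((hF.smoothOffZero.hasFDerivAt_right hΩ hx hy).pow 3).const_mul (-(c / 3))).fderiv
      simp only [Pi.smul_apply, hF.smoothOffZero.dy_eq hΩ hx hy]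
      simp only [dy, h]
      simp
      ring
    have h2 : ∑ j, (fundamentalTensor F x y)⁻¹ i j * dy j (fun x y => -(c / 3) * F x y ^ 3) x y =
        ((fundamentalTensor F x y)⁻¹ *ᵥ
          fun j => dy j (fun x y => -(c / 3) * F x y ^ 3) x y) i := rfl
    rw [h2, h1, mulVec_smul, hF.inv_mulVec_dy hΩ hx hy,
      hF.spray_eq_of_funk hΩ hx hy (fun y hy w => hc x hx y hy w)]
    simp
    ring

end DuallyFlat

/-! ### Rotation invariance and the level identity -/

section SphericallySymmetric

variable {Ω : Set (E n)} {F : E n → E n → ℝ} {x y : E n}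

lemma exp_zero_smul_apply (A : E n →L[ℝ] E n) (u : E n) :
    NormedSpace.exp ((0 : ℝ) • A) u = u := by
  have h : (0 : ℝ) • A = 0 := zero_smul ℝ A
  rw [h, NormedSpace.exp_zero]
  rfl

/-- The flow of a skew-symmetric map preserves inner products. -/
lemma inner_exp_smul (A : E n →L[ℝ] E n) (hA : ∀ u v, inner ℝ (A u) v = -inner ℝ u (A v))
    (u v : E n) (t : ℝ) :
    inner ℝ (NormedSpace.exp (t • A) u) (NormedSpace.exp (t • A) v) = inner ℝ u v := by
  have hd (u : E n) (t : ℝ) : HasDerivAt (fun t : ℝ => NormedSpace.exp (t • A) u)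
      (A (NormedSpace.exp (t • A) u)) t := by
    simpa using (hasDerivAt_exp_smul_const' A t).clm_apply (hasDerivAt_const t u)
  have h (t : ℝ) : HasDerivAt (fun t : ℝ =>
      inner ℝ (NormedSpace.exp (t • A) u) (NormedSpace.exp (t • A) v)) 0 t := by
    refine ((hd u t).inner ℝ (hd v t)).congr_deriv ?_
    rw [hA]; ring
  have := is_const_of_deriv_eq_zero (fun t => (h t).differentiableAt) (fun t => (h t).deriv) t 0
  simpa only [exp_zero_smul_apply] using this

/-- A spherically symmetric function is annihilated by infinitesimal rotations. -/
lemma SmoothOffZero.jointDeriv_skew (hF : SmoothOffZero Ω F) (hΩ : IsOpen Ω)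
    {φ : ℝ → ℝ → ℝ → ℝ} (hφ : ∀ x ∈ Ω, ∀ y, F x y = φ ‖x‖ ‖y‖ (inner ℝ x y))
    (A : E n →L[ℝ] E n) (hA : ∀ u v, inner ℝ (A u) v = -inner ℝ u (A v))
    (hx : x ∈ Ω) (hy : y ≠ 0) : jointDeriv F x y (A x, A y) = 0 := by
  have h0 (u : E n) : NormedSpace.exp ((0 : ℝ) • A) u = u := exp_zero_smul_apply A u
  have hd (u : E n) : HasDerivAt (fun t : ℝ => NormedSpace.exp (t • A) u) (A u) 0 := by
    simpa [h0] using
      (hasDerivAt_exp_smul_const' A (0 : ℝ)).clm_apply (hasDerivAt_const (0 : ℝ) u)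
  have hnorm (u : E n) (t : ℝ) : ‖NormedSpace.exp (t • A) u‖ = ‖u‖ := by
    rw [← sq_eq_sq₀ (norm_nonneg _) (norm_nonneg _), ← real_inner_self_eq_norm_sq,
      ← real_inner_self_eq_norm_sq, inner_exp_smul A hA]
  have h1 := hF.hasDerivAt_comp hΩ (t := 0) (a := fun t : ℝ => NormedSpace.exp (t • A) x)
    (b := fun t : ℝ => NormedSpace.exp (t • A) y) (by rwa [h0]) (by rwa [h0]) (hd x) (hd y)
  simp only [h0] at h1
  refine h1.unique ((hasDerivAt_const (0 : ℝ) (F x y)).congr_of_eventuallyEq ?_)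
  -- Ω need not be invariant under rotations; small t suffice.
  have hmem : ∀ᶠ t : ℝ in nhds 0, NormedSpace.exp (t • A) x ∈ Ω :=
    (hd x).continuousAt.eventually_mem (by rw [h0]; exact hΩ.mem_nhds hx)
  filter_upwards [hmem] with t ht
  rw [hφ _ ht, hφ x hx, hnorm, hnorm, inner_exp_smul A hA]

/-- For a spherically symmetric solution of `F_{xˡ} = C F F_{yˡ}`, the vector `y + C F x` is
proportional to the gradient of `F` in `y`. -/
lemma IsFinslerMetric.inner_eq_of_funk (hF : IsFinslerMetric Ω F) (hΩ : IsOpen Ω)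
    {φ : ℝ → ℝ → ℝ → ℝ} (hφ : ∀ x ∈ Ω, ∀ y, F x y = φ ‖x‖ ‖y‖ (inner ℝ x y)) {C : ℝ}
    (hx : x ∈ Ω) (hy : y ≠ 0)
    (hC : ∀ w, jointDeriv F x y (w, 0) = C * F x y * jointDeriv F x y (0, w)) (w : E n) :
    F x y * inner ℝ (y + (C * F x y) • x) w =
      inner ℝ (y + (C * F x y) • x) y * jointDeriv F x y (0, w) := by
  -- Generator of rotations in the plane of y and w. By the Funk equation, its annihilation of F
  -- reads F_y(A(y + CFx)) = 0; then F_y(y) = F gives the claim.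
  let A : E n →L[ℝ] E n := (innerSL ℝ w).smulRight y - (innerSL ℝ y).smulRight w
  have hAapp (u : E n) : A u = (inner ℝ w u : ℝ) • y - (inner ℝ y u : ℝ) • w := by simp [A]
  have hA (u v : E n) : inner ℝ (A u) v = -inner ℝ u (A v) := by
    simp only [hAapp, inner_sub_left, inner_sub_right, inner_smul_left, inner_smul_right]
    simp [real_inner_comm]
    ring
  have h1 := hF.smoothOffZero.jointDeriv_skew hΩ hφ A hA hx hy
  have hsub (a b : ℝ) : jointDeriv F x y (0, a • y - b • w) =
      a * F x y - b * jointDeriv F x y (0, w) := by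
    rw [← hF.euler hΩ hx hy, ← smul_eq_mul, ← smul_eq_mul, ← map_smul, ← map_smul, ← map_sub]
    simp
  rw [jointDeriv_apply_mk, hC, hAapp, hAapp, hsub, hsub] at h1
  have hc1 : (inner ℝ w x : ℝ) = inner ℝ x w := real_inner_comm _ _
  have hc2 : (inner ℝ w y : ℝ) = inner ℝ y w := real_inner_comm _ _
  have hc3 : (inner ℝ y x : ℝ) = inner ℝ x y := real_inner_comm _ _
  rw [hc1, hc2, hc3] at h1
  rw [inner_add_left, inner_add_left, real_inner_smul_left, real_inner_smul_left]
  linear_combination h1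

/-- The level identity `|y + C F x|² = k F²`, with `k` depending on `x` alone. -/
lemma IsFinslerMetric.exists_level (hn : 2 ≤ n) (hF : IsFinslerMetric Ω F) (hΩ : IsOpen Ω)
    {φ : ℝ → ℝ → ℝ → ℝ} (hφ : ∀ x ∈ Ω, ∀ y, F x y = φ ‖x‖ ‖y‖ (inner ℝ x y)) {C : E n → ℝ}
    (hCs : ContDiffOn ℝ ∞ C Ω)
    (hC : ∀ x ∈ Ω, ∀ y, y ≠ 0 → ∀ w,
      jointDeriv F x y (w, 0) = C x * F x y * jointDeriv F x y (0, w)) :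
    ∃ k : E n → ℝ, DifferentiableOn ℝ k Ω ∧ ∀ x ∈ Ω, ∀ y, y ≠ 0 →
      ‖y + (C x * F x y) • x‖ ^ 2 = k x * F x y ^ 2 := by
  obtain ⟨y₀, hy₀⟩ := (isConnected_compl_zero hn).nonempty
  have hconst {x : E n} (hx : x ∈ Ω) {y : E n} (hy : y ≠ 0) :
      ‖y + (C x * F x y) • x‖ ^ 2 * (F x y ^ 2)⁻¹ =
        ‖y₀ + (C x * F x y₀) • x‖ ^ 2 * (F x y₀ ^ 2)⁻¹ := by
    -- With z = y + CFx, the derivative along w is proportional to F⟨z, w⟩ + CF F_y(w)⟨z, x⟩ - |z|²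
    -- F_y(w). It vanishes because F⟨z, w⟩ = ⟨z, y⟩ F_y(w).
    have hdv (y : E n) (hy : y ≠ 0) :
        HasFDerivAt (fun y => ‖y + (C x * F x y) • x‖ ^ 2 * (F x y ^ 2)⁻¹)
          (0 : E n →L[ℝ] ℝ) y := by
      have hpos := hF.pos x hx y hy
      have h0 := hF.smoothOffZero.hasFDerivAt_right hΩ hx hy
      have h1 := ((hasFDerivAt_id y).add ((h0.const_mul (C x)).smul_const x)).norm_sq
      have h3 := h1.mul ((hasDerivAt_inv (pow_pos hpos 2).ne').comp_hasFDerivAt y (h0.pow 2))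
      refine h3.congr_fderiv ?_
      ext w
      have h4 := hF.inner_eq_of_funk hΩ hφ hx hy (hC x hx y hy) w
      have h5 : ‖y + (C x * F x y) • x‖ ^ 2 = ‖y‖ ^ 2 + 2 * (C x * F x y) * inner ℝ x y +
          (C x * F x y) ^ 2 * ‖x‖ ^ 2 := by
        rw [norm_add_sq_real, real_inner_smul_right, norm_smul, mul_pow, Real.norm_eq_abs, sq_abs,
          real_inner_comm]
        ring
      have hc : (inner ℝ y x : ℝ) = inner ℝ x y := real_inner_comm _ _
      simp only [inner_add_left, real_inner_smul_left, real_inner_self_eq_norm_sq] at h4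
      simp [h5, hc]
      field_simp
      linear_combination 2 * h4
    exact isOpen_compl_singleton.is_const_of_fderiv_eq_zero (𝕜 := ℝ)
      (isConnected_compl_zero hn).isPreconnected
      (fun y hy => (hdv y hy).differentiableAt.differentiableWithinAt)
      (fun y hy => (hdv y hy).fderiv) hy hy₀
  refine ⟨fun x => ‖y₀ + (C x * F x y₀) • x‖ ^ 2 * (F x y₀ ^ 2)⁻¹, fun x hx => ?_,
    fun x hx y hy => ?_⟩
  · have h1 : DifferentiableAt ℝ C x :=
      (hCs.contDiffAt (hΩ.mem_nhds hx)).differentiableAt (by simp)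
    have h2 := (hF.smoothOffZero.hasFDerivAt_left hΩ hx hy₀).differentiableAt
    have h3 : F x y₀ ^ 2 ≠ 0 := (pow_pos (hF.pos x hx y₀ hy₀) 2).ne'
    refine DifferentiableAt.differentiableWithinAt ?_
    exact (((differentiableAt_const y₀).add ((h1.mul h2).smul differentiableAt_id)).norm_sq ℝ).mul
      ((h2.pow 2).inv h3)
  · have := hconst hx hy
    have hpos := hF.pos x hx y hy
    simp only
    rw [← this]
    field_simp

/-- The derivative of the level identity in the directions that annihilate `F`. -/
lemma IsFinslerMetric.fderiv_level (hF : IsFinslerMetric Ω F) (hΩ : IsOpen Ω) {C k : E n → ℝ}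
    (hC : ∀ x ∈ Ω, ∀ y, y ≠ 0 → ∀ w,
      jointDeriv F x y (w, 0) = C x * F x y * jointDeriv F x y (0, w))
    (hCd : DifferentiableAt ℝ C x) (hkd : DifferentiableAt ℝ k x)
    (hk : ∀ x ∈ Ω, ∀ y, y ≠ 0 → ‖y + (C x * F x y) • x‖ ^ 2 = k x * F x y ^ 2)
    (hx : x ∈ Ω) (hy : y ≠ 0) (w : E n) :
    2 * fderiv ℝ C x w * (inner ℝ x y + C x * F x y * ‖x‖ ^ 2) = fderiv ℝ k x w * F x y := by
  have hpos := hF.pos x hx y hy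
  have ha : HasDerivAt (fun t : ℝ => x + t • w) w 0 := by
    simpa using ((hasDerivAt_id (0 : ℝ)).smul_const w).const_add x
  -- Along (w, -CFw) the function F is stationary, and the velocity -CFw of y cancels the term CFw
  -- from CFx. Only dC(w) F x remains in the derivative of y + CFx.
  have hb : HasDerivAt (fun t : ℝ => y + t • (-(C x * F x y)) • w) ((-(C x * F x y)) • w) 0 := by
    simpa using ((hasDerivAt_id (0 : ℝ)).smul_const ((-(C x * F x y)) • w)).const_add y
  have hf : HasDerivAt (fun t : ℝ => F (x + t • w) (y + t • (-(C x * F x y)) • w)) 0 0 := by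
    have h := hF.smoothOffZero.hasDerivAt_comp hΩ (t := 0) (by simpa) (by simpa) ha hb
    refine h.congr_deriv ?_
    have h2 : jointDeriv F x y (0, (-(C x * F x y)) • w) =
        (-(C x * F x y)) * jointDeriv F x y (0, w) := by
      rw [← smul_eq_mul (-(C x * F x y)), ← map_smul]; simp
    simp only [zero_smul, add_zero]
    rw [jointDeriv_apply_mk, hC x hx y hy, h2]
    ring
  have hC' : HasDerivAt (fun t : ℝ => C (x + t • w)) (fderiv ℝ C x w) 0 :=
    HasFDerivAt.comp_hasDerivAt (f := fun t : ℝ => x + t • w) 0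
      (by simpa using hCd.hasFDerivAt) ha
  have hk' : HasDerivAt (fun t : ℝ => k (x + t • w)) (fderiv ℝ k x w) 0 :=
    HasFDerivAt.comp_hasDerivAt (f := fun t : ℝ => x + t • w) 0
      (by simpa using hkd.hasFDerivAt) ha
  have h1 := (hb.add ((hC'.mul hf).smul ha)).norm_sq
  have h2 := hk'.mul (hf.pow 2)
  have h3 := h1.unique (h2.congr_of_eventuallyEq (by
    have hxm : ∀ᶠ t : ℝ in nhds 0, x + t • w ∈ Ω :=
      ha.continuousAt.eventually_mem (by simpa using hΩ.mem_nhds hx)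
    have hym : ∀ᶠ t : ℝ in nhds 0, y + t • (-(C x * F x y)) • w ∈ ({0}ᶜ : Set (E n)) :=
      hb.continuousAt.eventually_mem (by simpa using isOpen_compl_singleton.mem_nhds hy)
    filter_upwards [hxm, hym] with t htx hty using hk _ htx _ hty))
  simp [inner_add_left, inner_smul_left, inner_smul_right] at h3
  rw [real_inner_comm y x] at *
  refine mul_left_cancel₀ hpos.ne' ?_
  linear_combination h3

end SphericallySymmetric

/-! ### Constancy of the coefficients and the Funk family -/

section Classification

variable {Ω : Set (E n)} {F : E n → E n → ℝ} {x y : E n}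

lemma exists_ne_zero_inner_eq_zero (hn : 2 ≤ n) (x : E n) : ∃ y : E n, y ≠ 0 ∧ inner ℝ x y = 0 := by
  have h1 := Submodule.finrank_add_finrank_orthogonal (Submodule.span ℝ {x})
  have h2 : Module.finrank ℝ (Submodule.span ℝ {x}) ≤ 1 := (finrank_span_le_card ({x} : Set (E n))).trans (by simp)
  rw [finrank_euclideanSpace_fin] at h1
  have h3 : (Submodule.span ℝ {x})ᗮ ≠ ⊥ := by
    intro h
    rw [h, finrank_bot] at h1
    omega
  obtain ⟨y, hy, hy0⟩ := Submodule.exists_mem_ne_zero_of_ne_bot h3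
  exact ⟨y, hy0, Submodule.mem_orthogonal_singleton_iff_inner_right.1 hy⟩

/-- In the level identity of a spherically symmetric metric, both coefficients are constant. -/
lemma IsFinslerMetric.exists_const_level (hn : 2 ≤ n) (hF : IsFinslerMetric Ω F) (hΩ : IsOpen Ω)
    (hconv : Convex ℝ Ω)
    {φ : ℝ → ℝ → ℝ → ℝ} (hφ : ∀ x ∈ Ω, ∀ y, F x y = φ ‖x‖ ‖y‖ (inner ℝ x y)) {C : E n → ℝ}
    (hCs : ContDiffOn ℝ ∞ C Ω)
    (hC : ∀ x ∈ Ω, ∀ y, y ≠ 0 → ∀ w,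
      jointDeriv F x y (w, 0) = C x * F x y * jointDeriv F x y (0, w)) :
    ∃ k c : ℝ, ∀ x ∈ Ω, ∀ y, y ≠ 0 → ‖y + (c * F x y) • x‖ ^ 2 = k * F x y ^ 2 := by
  obtain ⟨k, hkd, hk⟩ := hF.exists_level hn hΩ hφ hCs hC
  have hCd {x : E n} (hx : x ∈ Ω) : DifferentiableAt ℝ C x :=
    (hCs.contDiffAt (hΩ.mem_nhds hx)).differentiableAt (by simp)
  have hkey {x : E n} (hx : x ∈ Ω) {y : E n} (hy : y ≠ 0) (w : E n) :=
    hF.fderiv_level hΩ hC (hCd hx) ((hkd x hx).differentiableAt (hΩ.mem_nhds hx)) hk hx hy w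
  -- Taking y ⟂ x gives dk = 2C|x|² dC; substituting this in the case y = x leaves |x|² dC = 0.
  have hC0' {x : E n} (hx : x ∈ Ω) (hx0 : x ≠ 0) : fderiv ℝ C x = 0 := by
    ext w
    obtain ⟨y, hy, hxy⟩ := exists_ne_zero_inner_eq_zero hn x
    have h1 := hkey hx hy w
    have h2 := hkey hx hx0 w
    have hy' := (hF.pos x hx y hy).ne'
    have h3 : 2 * fderiv ℝ C x w * (C x * ‖x‖ ^ 2) = fderiv ℝ k x w := by
      refine mul_right_cancel₀ hy' ?_
      rw [← h1, hxy]; ring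
    rw [← h3, real_inner_self_eq_norm_sq] at h2
    have h4 : fderiv ℝ C x w * ‖x‖ ^ 2 = 0 := by linear_combination h2 / 2
    simpa [hx0] using h4
  have : Nontrivial (E n) := by
    obtain ⟨y, hy, -⟩ := exists_ne_zero_inner_eq_zero hn 0
    exact ⟨y, 0, hy⟩
  have hC0 {x : E n} (hx : x ∈ Ω) : fderiv ℝ C x = 0 := by
    -- At the origin `hkey` says nothing about dC, which vanishes there by continuity.
    by_cases hx0 : x = 0
    · have hcont : ContinuousAt (fderiv ℝ C) x :=
        (hCs.continuousOn_fderiv_of_isOpen hΩ (by simp)).continuousAt (hΩ.mem_nhds hx)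
      have : Filter.NeBot (nhdsWithin x {x}ᶜ) := Module.punctured_nhds_neBot ℝ (E n) x
      refine tendsto_nhds_unique (l := nhdsWithin x {x}ᶜ) (hcont.tendsto.mono_left nhdsWithin_le_nhds)
        (tendsto_const_nhds.congr' ?_)
      filter_upwards [self_mem_nhdsWithin, nhdsWithin_le_nhds (hΩ.mem_nhds hx)] with z hz hzΩ
      exact (hC0' hzΩ (by rw [← hx0]; exact hz)).symm
    · exact hC0' hx hx0
  have hk0 {x : E n} (hx : x ∈ Ω) : fderiv ℝ k x = 0 := by
    ext w
    obtain ⟨y, hy, -⟩ := exists_ne_zero_inner_eq_zero hn x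
    have h1 := hkey hx hy w
    have hy' := (hF.pos x hx y hy).ne'
    rw [hC0 hx] at h1
    simpa [hy'] using h1.symm
  obtain ⟨c, hc⟩ := hΩ.exists_is_const_of_fderiv_eq_zero hconv.isPreconnected
    (fun x hx => (hCd hx).differentiableWithinAt) (fun x hx => hC0 hx)
  obtain ⟨k', hk'⟩ := hΩ.exists_is_const_of_fderiv_eq_zero hconv.isPreconnected hkd
    (fun x hx => hk0 hx)
  refine ⟨k', c, fun x hx y hy => ?_⟩
  rw [← hc x hx, ← hk' x hx]
  exact hk x hx y hy

lemma norm_add_smul_sq (x y : E n) (a : ℝ) :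
    ‖y + a • x‖ ^ 2 = ‖y‖ ^ 2 + 2 * a * inner ℝ x y + a ^ 2 * ‖x‖ ^ 2 := by
  rw [norm_add_sq_real, real_inner_smul_right, norm_smul, mul_pow, Real.norm_eq_abs, sq_abs,
    real_inner_comm]
  ring

/-- The positive solution of the quadratic equation defining the Funk family. -/
lemma eq_funkFamily {k c r u v f : ℝ} (hm : 0 < k - c ^ 2 * r ^ 2) (hf : 0 < f)
    (h : u ^ 2 + 2 * (c * f) * v + (c * f) ^ 2 * r ^ 2 = k * f ^ 2) :
    f = funkFamily k c r u v := by
  have h1 : 0 ≤ (k - c ^ 2 * r ^ 2) * f - c * v := by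
    have h2 : 0 ≤ 2 * f * ((k - c ^ 2 * r ^ 2) * f - c * v) := by
      -- This sign selects the root with +√ of the quadratic (k - c²r²)f² - 2cvf - u² = 0.
      have h3 : 2 * f * ((k - c ^ 2 * r ^ 2) * f - c * v) = (k - c ^ 2 * r ^ 2) * f ^ 2 + u ^ 2 := by
        linear_combination -h
      rw [h3]
      positivity
    exact nonneg_of_mul_nonneg_right h2 (by positivity)
  have h2 : (k - c ^ 2 * r ^ 2) * u ^ 2 + c ^ 2 * v ^ 2 =
      ((k - c ^ 2 * r ^ 2) * f - c * v) ^ 2 := by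
    linear_combination (k - c ^ 2 * r ^ 2) * h
  rw [funkFamily, h2, Real.sqrt_sq h1]
  field_simp
  ring

lemma IsFinslerMetric.apply_zero (hF : IsFinslerMetric Ω F) (hx : x ∈ Ω) : F x 0 = 0 := by
  have := hF.homog x hx 0 2 two_pos
  rw [smul_zero] at this
  linarith

/-- Projectively and dually flat spherically symmetric metrics belong to the Funk family. -/
lemma IsFinslerMetric.exists_eq_funkFamily (hn : 2 ≤ n) (hF : IsFinslerMetric Ω F)
    (hΩ : IsOpen Ω) (hconv : Convex ℝ Ω)
    {φ : ℝ → ℝ → ℝ → ℝ} (hφ : ∀ x ∈ Ω, ∀ y, F x y = φ ‖x‖ ‖y‖ (inner ℝ x y))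
    (hp : IsProjectivelyFlat Ω F) (hd : IsDuallyFlat Ω F) :
    ∃ k c : ℝ, (∀ x ∈ Ω, 0 < k - c ^ 2 * ‖x‖ ^ 2) ∧
      ∀ x ∈ Ω, ∀ y, F x y = funkFamily k c ‖x‖ ‖y‖ (inner ℝ x y) := by
  obtain ⟨C, hCs, hC⟩ := hd.exists_spray_eq hn hF hΩ fun x hx y hy => hp.spray_eq_smul hF hΩ hx hy
  obtain ⟨k, c, hkc⟩ := hF.exists_const_level hn hΩ hconv hφ hCs
    fun x hx y hy w => hF.funk_of_spray_eq hΩ hx (hC x hx) hy w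
  have hm (x : E n) (hx : x ∈ Ω) : 0 < k - c ^ 2 * ‖x‖ ^ 2 := by
    -- For y ⟂ x the level identity reduces to (k - c²|x|²)F² = |y|² > 0.
    obtain ⟨y, hy, hxy⟩ := exists_ne_zero_inner_eq_zero hn x
    have h1 := hkc x hx y hy
    have hpos := hF.pos x hx y hy
    rw [norm_add_smul_sq, hxy] at h1
    have h2 : (k - c ^ 2 * ‖x‖ ^ 2) * F x y ^ 2 = ‖y‖ ^ 2 := by linear_combination -h1
    have h3 : 0 < ‖y‖ ^ 2 := by positivity
    rw [← h2] at h3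
    exact pos_of_mul_pos_left h3 (by positivity)
  refine ⟨k, c, hm, fun x hx y => ?_⟩
  by_cases hy : y = 0
  · simp [hy, hF.apply_zero hx, funkFamily]
  · refine eq_funkFamily (hm x hx) (hF.pos x hx y hy) ?_
    rw [← norm_add_smul_sq]
    exact hkc x hx y hy

/-- Multiplied by m = k - c²r², it becomes the square of mf - cv = √(mu² + c²v²). -/
lemma funkFamily_quadratic {k c r u v : ℝ} (hm : 0 < k - c ^ 2 * r ^ 2) :
    u ^ 2 + 2 * (c * funkFamily k c r u v) * v + (c * funkFamily k c r u v) ^ 2 * r ^ 2 =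
      k * funkFamily k c r u v ^ 2 := by
  have h : 0 ≤ (k - c ^ 2 * r ^ 2) * u ^ 2 + c ^ 2 * v ^ 2 := by positivity
  have hs := Real.sq_sqrt h
  have hf : (k - c ^ 2 * r ^ 2) * funkFamily k c r u v =
      √((k - c ^ 2 * r ^ 2) * u ^ 2 + c ^ 2 * v ^ 2) + c * v := by
    rw [funkFamily, mul_div_cancel₀ _ hm.ne']
  refine mul_left_cancel₀ hm.ne' ?_
  generalize √((k - c ^ 2 * r ^ 2) * u ^ 2 + c ^ 2 * v ^ 2) = s at *
  generalize funkFamily k c r u v = f at *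
  have h2 : ((k - c ^ 2 * r ^ 2) * f - c * v) ^ 2 =
      (k - c ^ 2 * r ^ 2) * u ^ 2 + c ^ 2 * v ^ 2 := by
    rw [hf, ← hs]; ring
  linear_combination -h2

/-- Metrics in the Funk family satisfy `F_{xˡ} = c F F_{yˡ}`. -/
lemma IsFinslerMetric.funk_of_eq_funkFamily (hF : IsFinslerMetric Ω F) (hΩ : IsOpen Ω) {k c : ℝ}
    (hm : ∀ x ∈ Ω, 0 < k - c ^ 2 * ‖x‖ ^ 2)
    (hfk : ∀ x ∈ Ω, ∀ y, F x y = funkFamily k c ‖x‖ ‖y‖ (inner ℝ x y))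
    (hx : x ∈ Ω) (hy : y ≠ 0) (w : E n) :
    jointDeriv F x y (w, 0) = c * F x y * jointDeriv F x y (0, w) := by
  have hk (x : E n) (hx : x ∈ Ω) (y : E n) : ‖y + (c * F x y) • x‖ ^ 2 = k * F x y ^ 2 := by
    rw [norm_add_smul_sq, hfk x hx y]
    exact funkFamily_quadratic (hm x hx)
  have hpos := hF.pos x hx y hy
  have ha : HasDerivAt (fun t : ℝ => x + t • w) w 0 := by
    simpa using ((hasDerivAt_id (0 : ℝ)).smul_const w).const_add x
  have hb : HasDerivAt (fun t : ℝ => y + t • (-(c * F x y)) • w) ((-(c * F x y)) • w) 0 := by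
    simpa using ((hasDerivAt_id (0 : ℝ)).smul_const ((-(c * F x y)) • w)).const_add y
  -- d is the derivative of F along (w, -cFw). Differentiating the quadratic in this direction
  -- leaves d times a factor, which `h5` shows to be negative.
  obtain ⟨d, hd⟩ : ∃ d, d = jointDeriv F x y (w, 0) - c * F x y * jointDeriv F x y (0, w) :=
    ⟨_, rfl⟩
  have hf : HasDerivAt (fun t : ℝ => F (x + t • w) (y + t • (-(c * F x y)) • w)) d 0 := by
    have h := hF.smoothOffZero.hasDerivAt_comp hΩ (t := 0) (by simpa) (by simpa) ha hb
    refine h.congr_deriv ?_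
    have h2 : jointDeriv F x y (0, (-(c * F x y)) • w) =
        (-(c * F x y)) * jointDeriv F x y (0, w) := by
      rw [← smul_eq_mul (-(c * F x y)), ← map_smul]; simp
    simp only [zero_smul, add_zero]
    rw [jointDeriv_apply_mk, h2, hd]
    ring
  have h1 := (hb.add ((hf.const_mul c).smul ha)).norm_sq
  have h2 := (hf.pow 2).const_mul k
  have h3 := h1.unique (h2.congr_of_eventuallyEq (by
    have hxm : ∀ᶠ t : ℝ in nhds 0, x + t • w ∈ Ω :=
      ha.continuousAt.eventually_mem (by simpa using hΩ.mem_nhds hx)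
    filter_upwards [hxm] with t htx using hk _ htx _))
  simp [inner_add_left, inner_smul_left, inner_smul_right] at h3
  rw [real_inner_comm x y] at *
  have h4 : d * (c * inner ℝ x y + c ^ 2 * F x y * ‖x‖ ^ 2 - k * F x y) = 0 := by
    linear_combination h3 / 2
  have h5 : c * inner ℝ x y + c ^ 2 * F x y * ‖x‖ ^ 2 - k * F x y < 0 := by
    have h6 := hk x hx y
    rw [norm_add_smul_sq] at h6
    have h7 : 2 * F x y * (c * inner ℝ x y + c ^ 2 * F x y * ‖x‖ ^ 2 - k * F x y) =
        -((k - c ^ 2 * ‖x‖ ^ 2) * F x y ^ 2 + ‖y‖ ^ 2) := by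
      linear_combination h6
    have h8 := hm x hx
    have h9 : 0 < (k - c ^ 2 * ‖x‖ ^ 2) * F x y ^ 2 + ‖y‖ ^ 2 := by positivity
    by_contra! h10
    have : 0 ≤ 2 * F x y * (c * inner ℝ x y + c ^ 2 * F x y * ‖x‖ ^ 2 - k * F x y) := by
      positivity
    linarith
  have h6 : d = 0 := (mul_eq_zero.1 h4).resolve_right h5.ne
  linarith

/-- Only |x|², |y|² and ⟨x, y⟩ enter, so x = 0 is harmless, and y ≠ 0 keeps the radicand positive.
-/
lemma contDiffOn_funkFamily :
    ContDiffOn ℝ ∞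
      (fun p : (ℝ × ℝ) × E n × E n => funkFamily p.1.1 p.1.2 ‖p.2.1‖ ‖p.2.2‖ (inner ℝ p.2.1 p.2.2))
      {p | 0 < p.1.1 - p.1.2 ^ 2 * ‖p.2.1‖ ^ 2 ∧ p.2.2 ≠ 0} := by
  have hx : ContDiff ℝ ∞ fun p : (ℝ × ℝ) × E n × E n => ‖p.2.1‖ ^ 2 :=
    (contDiff_fst.comp contDiff_snd).norm_sq ℝ
  have hy : ContDiff ℝ ∞ fun p : (ℝ × ℝ) × E n × E n => ‖p.2.2‖ ^ 2 :=
    (contDiff_snd.comp contDiff_snd).norm_sq ℝ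
  have hv : ContDiff ℝ ∞ fun p : (ℝ × ℝ) × E n × E n => (inner ℝ p.2.1 p.2.2 : ℝ) :=
    (contDiff_fst.comp contDiff_snd).inner ℝ (contDiff_snd.comp contDiff_snd)
  have hk : ContDiff ℝ ∞ fun p : (ℝ × ℝ) × E n × E n => p.1.1 := by fun_prop
  have hc : ContDiff ℝ ∞ fun p : (ℝ × ℝ) × E n × E n => p.1.2 := by fun_prop
  have hm := hk.sub ((hc.pow 2).mul hx)
  have hroot := (hm.mul hy).add ((hc.pow 2).mul (hv.pow 2))
  refine ((hroot.contDiffOn.sqrt ?_).add (hc.mul hv).contDiffOn).div hm.contDiffOn ?_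
  · rintro p ⟨h1, h2⟩
    have h3 : 0 < ‖p.2.2‖ ^ 2 := by positivity
    have h4 := mul_pos h1 h3
    positivity
  · exact fun p hp => hp.1.ne'

lemma funkFamily_one_one (x y : E n) :
    funkFamily 1 1 ‖x‖ ‖y‖ (inner ℝ x y) = funkMetric x y := by
  simp only [funkFamily, funkMetric, one_pow, one_mul]
  congr 3
  ring

end Classification

end FinslerGeom

end

theorem theorem1 (n : ℕ) (hn : 2 ≤ n) :
    (∀ (Ω : Set (EuclideanSpace ℝ (Fin n))), IsOpen Ω → Convex ℝ Ω →
      ∀ (F : EuclideanSpace ℝ (Fin n) → EuclideanSpace ℝ (Fin n) → ℝ) (φ : ℝ → ℝ → ℝ → ℝ),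
        FinslerGeom.IsFinslerMetric Ω F →
        (∀ x ∈ Ω, ∀ y, F x y = φ ‖x‖ ‖y‖ (inner ℝ x y)) →
        ((FinslerGeom.IsProjectivelyFlat Ω F ∧ FinslerGeom.IsDuallyFlat Ω F) ↔
          ∃ k c : ℝ, (∀ x ∈ Ω, 0 < k - c ^ 2 * ‖x‖ ^ 2) ∧
            ∀ x ∈ Ω, ∀ y : EuclideanSpace ℝ (Fin n),
              φ ‖x‖ ‖y‖ (inner ℝ x y) =
                FinslerGeom.funkFamily k c ‖x‖ ‖y‖ (inner ℝ x y))) ∧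
    ContDiffOn ℝ ∞
      (fun p : (ℝ × ℝ) × EuclideanSpace ℝ (Fin n) × EuclideanSpace ℝ (Fin n) =>
        FinslerGeom.funkFamily p.1.1 p.1.2 ‖p.2.1‖ ‖p.2.2‖ (inner ℝ p.2.1 p.2.2))
      {p | 0 < p.1.1 - p.1.2 ^ 2 * ‖p.2.1‖ ^ 2 ∧ p.2.2 ≠ 0} ∧
    (∀ x ∈ Metric.ball (0 : EuclideanSpace ℝ (Fin n)) 1, ∀ y : EuclideanSpace ℝ (Fin n),
      FinslerGeom.funkFamily 1 1 ‖x‖ ‖y‖ (inner ℝ x y) = FinslerGeom.funkMetric x y) := by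
  refine ⟨fun Ω hΩ hconv F φ hF hφ => ⟨fun ⟨hp, hd⟩ => ?_, fun ⟨k, c, hm, hfk⟩ => ?_⟩,
    FinslerGeom.contDiffOn_funkFamily, fun x _ y => FinslerGeom.funkFamily_one_one x y⟩
  · obtain ⟨k, c, hm, h⟩ := hF.exists_eq_funkFamily hn hΩ hconv hφ hp hd
    exact ⟨k, c, hm, fun x hx y => by rw [← hφ x hx y, h x hx y]⟩
  · have hfunk : ∀ x ∈ Ω, ∀ y, y ≠ 0 → ∀ w, FinslerGeom.jointDeriv F x y (w, 0) =
        c * F x y * FinslerGeom.jointDeriv F x y (0, w) := fun x hx y hy w =>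
      hF.funk_of_eq_funkFamily hΩ hm (fun x hx y => by rw [hφ x hx y, hfk x hx y]) hx hy w
    exact ⟨FinslerGeom.isProjectivelyFlat_of_spray_eq_smul fun x hx y hy =>
      ⟨_, hF.spray_eq_of_funk hΩ hx hy (hfunk x hx)⟩, hF.isDuallyFlat_of_funk hΩ hfunk⟩
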